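/- Let $X$ be a finite-dimensional real Hilbert space, and let $\mathcal{C}$ be a nonempty finite collection of nonempty polyhedral subsets of $X$, where a polyhedral set is an intersection of finitely many closed halfspaces. For $C\in\mathcal{C}$, let $P_C\colon X\to X$ be the projector that maps each point of $X$ to its unique nearest point in $C$. Let $\lambda\in[0,2)$ and let $x_0\in X$. Let $(x_n)_{n\in\mathbb{N}}$ be a sequence in $X$ starting at $x_0$ such that, for every $n\in\mathbb{N}$, $$x_{n+1}=R_nx_n\quad\text{for some}\quad R_n\in\{(1-\mu)\operatorname{Id}+\mu P_C : C\in\mathcal{C},\ \mu\in[0,\lambda]\}.$$ Then the sequence $(x_n)_{n\in\mathbb{N}}$ is bounded. -/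

import Mathlib

section

variable {X : Type*} [NormedAddCommGroup X] [InnerProductSpace ℝ X]

/-- A closed halfspace `{x | ⟪a, x⟫ ≤ β}` with `a ≠ 0`. -/
def IsClosedHalfspace (H : Set X) : Prop :=
  ∃ (a : X) (β : ℝ), a ≠ 0 ∧ H = {x : X | inner ℝ a x ≤ β}

/-- A polyhedral set: the intersection of finitely many closed halfspaces
(the whole space is the intersection of the empty family). -/
def IsPolyhedralSet (C : Set X) : Prop :=
  ∃ 𝓗 : Set (Set X), 𝓗.Finite ∧ (∀ H ∈ 𝓗, IsClosedHalfspace H) ∧ C = ⋂₀ 𝓗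

/-- `p` is a nearest point to `x` in `C`. -/
def IsNearestPoint (C : Set X) (x p : X) : Prop :=
  p ∈ C ∧ ∀ z ∈ C, ‖x - p‖ ≤ ‖x - z‖

open Classical in
/-- The orthogonal projector `P_C`: it sends `x` to its nearest point in `C`. That point exists and
is unique when `C` is nonempty, closed and convex; `x` is a dummy value where no nearest point
exists. -/
noncomputable def projector (C : Set X) (x : X) : X :=
  if h : ∃ p, IsNearestPoint C x p then h.choose else x

/-- The set of relaxed projectors `(1 - μ) Id + μ P_C` with `C ∈ 𝒞` and `μ ∈ Λ`. -/
def relaxedProjectors (𝒞 : Set (Set X)) (Λ : Set ℝ) : Set (X → X) :=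
  {R | ∃ C ∈ 𝒞, ∃ μ ∈ Λ, R = fun x => (1 - μ) • x + μ • projector C x}

/-- Polyhedral sets are closed. -/
theorem IsPolyhedralSet.isClosed {C : Set X} (hC : IsPolyhedralSet C) : IsClosed C := by
  obtain ⟨𝓗, -, h, rfl⟩ := hC
  refine isClosed_sInter fun H hH => ?_
  obtain ⟨a, β, -, rfl⟩ := h H hH
  exact isClosed_le (by fun_prop) continuous_const

/-- Polyhedral sets are convex. -/
theorem IsPolyhedralSet.convex {C : Set X} (hC : IsPolyhedralSet C) : Convex ℝ C := by
  obtain ⟨𝓗, -, h, rfl⟩ := hC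
  refine convex_sInter fun H hH => ?_
  obtain ⟨a, β, -, rfl⟩ := h H hH
  exact convex_halfSpace_le (innerₛₗ ℝ a).isLinear β

/-- Nearest points in a convex set are unique. -/
theorem IsNearestPoint.unique {C : Set X} (hC : Convex ℝ C) {x p q : X}
    (hp : IsNearestPoint C x p) (hq : IsNearestPoint C x q) : p = q := by
  have hm : (2⁻¹ : ℝ) • p + (2⁻¹ : ℝ) • q ∈ C :=
    hC hp.1 hq.1 (by norm_num) (by norm_num) (by norm_num)
  have h1 := hp.2 _ hm
  have h2 := hq.2 _ hp.1
  have h3 := hp.2 _ hq.1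
  have e : x - ((2⁻¹ : ℝ) • p + (2⁻¹ : ℝ) • q) = (2⁻¹ : ℝ) • ((x - p) + (x - q)) := by
    module
  rw [e, norm_smul] at h1
  have h4 := parallelogram_law_with_norm ℝ (x - p) (x - q)
  have e2 : (x - p) - (x - q) = q - p := by abel
  rw [e2] at h4
  have h5 : ‖x - p‖ = ‖x - q‖ := le_antisymm h3 h2
  norm_num at h1
  have h6 : ‖q - p‖ = 0 := by
    nlinarith [norm_nonneg (q - p), norm_nonneg (x - p), norm_nonneg (x - p + (x - q))]
  exact (sub_eq_zero.1 (norm_eq_zero.1 h6)).symm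

/-- The projector onto a nonempty closed subset of a finite-dimensional space attains the
distance. -/
theorem projector_isNearestPoint [FiniteDimensional ℝ X] {C : Set X} (hne : C.Nonempty)
    (hcl : IsClosed C) (x : X) : IsNearestPoint C x (projector C x) := by
  have : ProperSpace X := FiniteDimensional.proper ℝ X
  obtain ⟨p, hp, h⟩ := hcl.exists_infDist_eq_dist hne x
  have hex : ∃ p, IsNearestPoint C x p := by
    refine ⟨p, hp, fun z hz => ?_⟩
    rw [← dist_eq_norm, ← dist_eq_norm, ← h]
    exact Metric.infDist_le_dist_of_mem hz
  rw [projector, dif_pos hex]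
  exact hex.choose_spec

end

/-! At each point, the projector onto a polyhedral set is the projection onto an affine subspace cut
out by the active constraints, and only finitely many such subspaces occur
(`IsPolyhedralSet.exists_finite_affine`). A step with parameter `μ ≤ r` is a convex combination of
the identity and the step with parameter `r`. So the convex hull of the orbit under the finitely
many `r`-relaxed affine projections traps the sequence (`exists_bounded_invariant`).

That this orbit is bounded is proved by induction on the set of letters
(`exists_norm_applyWord_le`). Cut a word into shortest blocks using every letter. The linear part of
a block contracts by a uniform `c < 1` orthogonally to the common fixed points
(`exists_contraction_covering`). A block without its last letter misses that letter, so the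
induction hypothesis bounds its drift. -/

section RandomProducts

/-! ### Products of symmetric nonexpansive maps -/

variable {ι X : Type*} [NormedAddCommGroup X] [InnerProductSpace ℝ X]

/-- The common fixed points of the operators `T i`, `i ∈ S`. -/
def commonFixed (T : ι → X →ₗ[ℝ] X) (S : Finset ι) : Submodule ℝ X :=
  ⨅ i ∈ S, LinearMap.eqLocus (T i) LinearMap.id

theorem mem_commonFixed {T : ι → X →ₗ[ℝ] X} {S : Finset ι} {x : X} :
    x ∈ commonFixed T S ↔ ∀ i ∈ S, T i x = x := by
  simp [commonFixed]

/-- The affine maps `x ↦ T i x + b i`, applied successively along a word. -/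
def applyWord (T : ι → X →ₗ[ℝ] X) (b : ι → X) (w : List ι) (x : X) : X :=
  w.foldl (fun y i => T i y + b i) x

@[simp] theorem applyWord_nil (T : ι → X →ₗ[ℝ] X) (b : ι → X) (x : X) :
    applyWord T b [] x = x := rfl

@[simp] theorem applyWord_cons (T : ι → X →ₗ[ℝ] X) (b : ι → X) (i : ι) (w : List ι) (x : X) :
    applyWord T b (i :: w) x = applyWord T b w (T i x + b i) := rfl

theorem applyWord_append (T : ι → X →ₗ[ℝ] X) (b : ι → X) (v w : List ι) (x : X) :
    applyWord T b (v ++ w) x = applyWord T b w (applyWord T b v x) :=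
  List.foldl_append

theorem applyWord_add (T : ι → X →ₗ[ℝ] X) (b : ι → X) (w : List ι) (x y : X) :
    applyWord T b w (x + y) = applyWord T 0 w x + applyWord T b w y := by
  induction w generalizing x y with
  | nil => rfl
  | cons i w ih =>
    simp only [applyWord_cons, Pi.zero_apply, add_zero, map_add]
    rw [add_assoc, ih]

theorem norm_applyWord_zero_le {T : ι → X →ₗ[ℝ] X} (hle : ∀ i x, ‖T i x‖ ≤ ‖x‖)
    (w : List ι) (x : X) : ‖applyWord T 0 w x‖ ≤ ‖x‖ := by
  induction w generalizing x with
  | nil => rfl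
  | cons i w ih => simpa using (ih _).trans (hle i x)

theorem applyWord_zero_of_mem_commonFixed {T : ι → X →ₗ[ℝ] X} {S : Finset ι} {w : List ι}
    (hw : ∀ i ∈ w, i ∈ S) {x : X} (hx : x ∈ commonFixed T S) : applyWord T 0 w x = x := by
  induction w with
  | nil => rfl
  | cons i w ih =>
    rw [List.forall_mem_cons] at hw
    simp [mem_commonFixed.1 hx i hw.1, ih hw.2]

/-- By symmetry `⟪u, T i x⟫ = ⟪T i u, x⟫ = ⟪u, x⟫` for fixed `u`. This keeps orbits where covering
words contract. -/
theorem applyWord_mem_orthogonal {T : ι → X →ₗ[ℝ] X} (hsymm : ∀ i, (T i).IsSymmetric)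
    {b : ι → X} {S : Finset ι} (hb : ∀ i ∈ S, b i ∈ (commonFixed T S)ᗮ) {w : List ι}
    (hw : ∀ i ∈ w, i ∈ S) {x : X} (hx : x ∈ (commonFixed T S)ᗮ) :
    applyWord T b w x ∈ (commonFixed T S)ᗮ := by
  induction w generalizing x with
  | nil => exact hx
  | cons i w ih =>
    rw [List.forall_mem_cons] at hw
    refine ih hw.2 (Submodule.add_mem _ (fun u hu => ?_) (hb i hw.1))
    rw [← hsymm i u x, mem_commonFixed.1 hu i hw.1]
    exact hx u hu

/-- A word in which all letters of a nonempty set `S` occur has a shortest such prefix. -/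
theorem exists_prefix_covering [DecidableEq ι] {S : Finset ι} (hS : S.Nonempty) {w : List ι}
    (hw : w.toFinset = S) :
    ∃ i ∈ S, ∃ u v : List ι, w = u ++ i :: v ∧ u.toFinset = S.erase i := by
  induction w using List.reverseRecOn with
  | nil => simp [← hw] at hS
  | append_singleton w i ih =>
    by_cases h : w.toFinset = S
    · obtain ⟨j, hj, u, v, rfl, hu⟩ := ih h
      exact ⟨j, hj, u, v ++ [i], by simp, hu⟩
    · have hi : i ∉ w.toFinset := fun hi => h (by
        rw [← hw, List.toFinset_append]
        ext j
        simp only [Finset.mem_union, List.mem_toFinset, List.mem_singleton]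
        constructor
        · exact Or.inl
        · rintro (h | rfl)
          · exact h
          · simpa using hi)
      refine ⟨i, by simp [← hw], w, [], rfl, ?_⟩
      rw [← hw]
      ext j
      simp only [List.mem_toFinset, Finset.mem_erase, List.mem_append, List.mem_singleton] at hi ⊢
      constructor
      · exact fun hj => ⟨fun e => hi (e ▸ hj), Or.inl hj⟩
      · rintro ⟨h1, h2 | h2⟩
        · exact h2
        · exact absurd h2 h1

/-- Let `T i` be a nonexpansive map that preserves the norm of its fixed points only. If the
component of `x ⊥ fix (T i) ∩ N` orthogonal to `N` is shrunk by the factor `c < 1` before `T i` is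
applied, then the norm is reduced by a uniform factor. -/
theorem exists_contraction_step [FiniteDimensional ℝ X] {T : X →ₗ[ℝ] X}
    (hle : ∀ x, ‖T x‖ ≤ ‖x‖) (heq : ∀ x, ‖T x‖ = ‖x‖ → T x = x)
    {M N : Submodule ℝ X} (hM : ∀ x ∈ N, T x = x → x ∈ M) {c : ℝ} (hc0 : 0 ≤ c) (hc : c < 1) :
    ∃ q : ℝ, 0 ≤ q ∧ q < 1 ∧ ∀ u ∈ N, ∀ v ∈ Nᗮ, ∀ v' ∈ Nᗮ, u + v ∈ Mᗮ → ‖v'‖ ≤ c * ‖v‖ →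
      ‖T (u + v')‖ ≤ q * ‖u + v‖ := by
  have : ProperSpace X := FiniteDimensional.proper ℝ X
  have pyth : ∀ u ∈ N, ∀ v ∈ Nᗮ, ‖u + v‖ ^ 2 = ‖u‖ ^ 2 + ‖v‖ ^ 2 := fun u hu v hv => by
    have := norm_add_sq_eq_norm_sq_add_norm_sq_of_inner_eq_zero u v (hv u hu)
    simpa only [sq] using this
  -- Here `v'` is a free variable rather than the image of `v` under a word, so one compact set
  -- serves all words.
  let K : Set (X × X × X) := {z | z.1 ∈ N ∧ z.2.1 ∈ Nᗮ ∧ z.2.2 ∈ Nᗮ ∧ z.1 + z.2.1 ∈ Mᗮ ∧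
    ‖z.2.2‖ ≤ c * ‖z.2.1‖ ∧ ‖z.1 + z.2.1‖ = 1}
  have hKc : IsCompact K := by
    refine (isCompact_closedBall (0 : X × X × X) 1).of_isClosed_subset ?_ ?_
    · have hN := N.closed_of_finiteDimensional
      have hN' := Nᗮ.closed_of_finiteDimensional
      have hM' := Mᗮ.closed_of_finiteDimensional
      refine (hN.preimage (by fun_prop : Continuous fun z : X × X × X => z.1)).inter <|
        (hN'.preimage (by fun_prop : Continuous fun z : X × X × X => z.2.1)).inter <|
        (hN'.preimage (by fun_prop : Continuous fun z : X × X × X => z.2.2)).inter <|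
        (hM'.preimage (by fun_prop : Continuous fun z : X × X × X => z.1 + z.2.1)).inter <|
        (isClosed_le (f := fun z : X × X × X => ‖z.2.2‖) (g := fun z => c * ‖z.2.1‖)
          (by fun_prop) (by fun_prop)).inter
        (isClosed_eq (f := fun z : X × X × X => ‖z.1 + z.2.1‖) (g := fun _ => 1)
          (by fun_prop) (by fun_prop))
    · rintro ⟨u, v, v'⟩ ⟨hu, hv, -, -, h, h1⟩
      simp only at hu hv h h1
      have hp := pyth u hu v hv
      rw [h1] at hp
      have hu1 : ‖u‖ ≤ 1 := by nlinarith [norm_nonneg u, sq_nonneg ‖v‖]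
      have hv1 : ‖v‖ ≤ 1 := by nlinarith [norm_nonneg v, sq_nonneg ‖u‖]
      have hv'1 : ‖v'‖ ≤ 1 := h.trans (mul_le_one₀ hc.le (norm_nonneg v) hv1)
      simp [Prod.norm_def, hu1, hv1, hv'1]
  have hlt : ∀ z ∈ K, ‖T (z.1 + z.2.2)‖ < 1 := by
    rintro ⟨u, v, v'⟩ ⟨hu, hv, hv', hm, h, h1⟩
    simp only at hu hv hv' hm h h1 ⊢
    by_contra! hcon
    have hp := pyth u hu v hv
    have hp' := pyth u hu v' hv'
    rw [h1] at hp
    have hT := hle (u + v')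
    have hvv : ‖v'‖ ^ 2 ≤ c ^ 2 * ‖v‖ ^ 2 := by
      rw [← mul_pow]; exact pow_le_pow_left₀ (norm_nonneg _) h 2
    have hc2 : c ^ 2 < 1 := pow_lt_one₀ hc0 hc two_ne_zero
    have h2 : 1 ≤ ‖u + v'‖ ^ 2 := one_le_pow₀ (hcon.trans hT)
    -- No loss of norm means `‖u‖² + ‖v‖² = 1 ≤ ‖u‖² + c²‖v‖²`, which forces `v = 0`. Then `u` is
    -- fixed by `T` and lies in both `M` and `Mᗮ`.
    have hv0 : ‖v‖ ^ 2 = 0 := by nlinarith [sq_nonneg ‖v‖]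
    have hv0' : v = 0 := by simpa using hv0
    have hv'0 : v' = 0 := by
      rw [hv0', norm_zero, mul_zero] at h
      simpa using h
    subst hv0' hv'0
    simp only [add_zero] at *
    have hfix := heq u (le_antisymm (hle u) (h1 ▸ hcon))
    have hu0 : u = 0 := by
      have := hm u (hM u hu hfix)
      simpa using this
    simp [hu0] at h1
  obtain ⟨q, hq0, hq1, hq⟩ : ∃ q : ℝ, 0 ≤ q ∧ q < 1 ∧ ∀ z ∈ K, ‖T (z.1 + z.2.2)‖ ≤ q := by
    rcases K.eq_empty_or_nonempty with hK | hK
    · exact ⟨0, le_rfl, one_pos, by simp [hK]⟩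
    · have hcont : Continuous fun z : X × X × X => ‖T (z.1 + z.2.2)‖ := by
        have := T.continuous_of_finiteDimensional
        fun_prop
      obtain ⟨z, hz, hmax⟩ := hKc.exists_isMaxOn hK hcont.continuousOn
      exact ⟨_, norm_nonneg _, hlt z hz, fun y hy => hmax hy⟩
  refine ⟨q, hq0, hq1, fun u hu v hv v' hv' hm h => ?_⟩
  rcases eq_or_ne (u + v) 0 with h0 | h0
  · have hp := pyth u hu v hv
    rw [h0, norm_zero] at hp
    have hu0 : u = 0 := by
      rw [← norm_eq_zero]; nlinarith [sq_nonneg ‖u‖, sq_nonneg ‖v‖]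
    have hv0 : v = 0 := by simpa [hu0] using h0
    have hv'0 : v' = 0 := by simpa [hv0] using h
    simp [hu0, hv0, hv'0]
  · set r := ‖u + v‖ with hr
    have hr0 : 0 < r := norm_pos_iff.2 h0
    have hz := hq (r⁻¹ • u, r⁻¹ • v, r⁻¹ • v')
      ⟨N.smul_mem _ hu, Nᗮ.smul_mem _ hv, Nᗮ.smul_mem _ hv', by
        simpa only [smul_add] using Mᗮ.smul_mem r⁻¹ hm, by
        simp only [norm_smul]
        rw [mul_left_comm]
        gcongr, by
        simp only [← smul_add, norm_smul, ← hr, norm_inv, Real.norm_of_nonneg hr0.le]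
        exact inv_mul_cancel₀ hr0.ne'⟩
    simp only [← smul_add, map_smul, norm_smul, norm_inv, Real.norm_of_nonneg hr0.le] at hz
    rwa [inv_mul_le_iff₀ hr0, mul_comm] at hz

/-- Products of nonexpansive symmetric operators `T i` in which all indices of `S` occur contract
uniformly on the orthogonal complement of the common fixed points. -/
theorem exists_contraction_covering [FiniteDimensional ℝ X] [DecidableEq ι] {T : ι → X →ₗ[ℝ] X}
    (hsymm : ∀ i, (T i).IsSymmetric) (hle : ∀ i x, ‖T i x‖ ≤ ‖x‖)
    (heq : ∀ i x, ‖T i x‖ = ‖x‖ → T i x = x) (S : Finset ι) :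
    ∃ c : ℝ, 0 ≤ c ∧ c < 1 ∧ ∀ w : List ι, w.toFinset = S → ∀ x ∈ (commonFixed T S)ᗮ,
      ‖applyWord T 0 w x‖ ≤ c * ‖x‖ := by
  induction S using Finset.strongInduction with
  | H S ih =>
    rcases S.eq_empty_or_nonempty with rfl | hS
    · refine ⟨0, le_rfl, one_pos, fun w _ x hx => ?_⟩
      have h0 : x = 0 := by simpa using hx x (mem_commonFixed.2 (by simp))
      subst h0
      simpa using norm_applyWord_zero_le hle w (0 : X)
    have step : ∀ i ∈ S, ∃ q : ℝ, 0 ≤ q ∧ q < 1 ∧ ∀ u : List ι, u.toFinset = S.erase i →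
        ∀ x ∈ (commonFixed T S)ᗮ, ‖T i (applyWord T 0 u x)‖ ≤ q * ‖x‖ := by
      intro i hi
      obtain ⟨c, hc0, hc1, hc⟩ := ih _ (Finset.erase_ssubset hi)
      obtain ⟨q, hq0, hq1, hq⟩ := exists_contraction_step (hle i) (heq i)
        (M := commonFixed T S) (N := commonFixed T (S.erase i)) (fun x hx hxi => by
          rw [mem_commonFixed] at hx ⊢
          intro j hj
          rcases eq_or_ne j i with rfl | hji
          · exact hxi
          · exact hx j (Finset.mem_erase.2 ⟨hji, hj⟩)) hc0 hc1
      refine ⟨q, hq0, hq1, fun u hu x hx => ?_⟩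
      have hu' : ∀ j ∈ u, j ∈ S.erase i := fun j hj => hu ▸ List.mem_toFinset.2 hj
      -- The word `u` fixes `y` and shrinks `z` by the factor `c`.
      obtain ⟨y, hy, z, hz, rfl⟩ := (commonFixed T (S.erase i)).exists_add_mem_mem_orthogonal x
      rw [applyWord_add, applyWord_zero_of_mem_commonFixed hu' hy]
      exact hq y hy z hz _ (applyWord_mem_orthogonal hsymm (by simp) hu' hz) hx (hc u hu z hz)
    choose! q hq0 hq1 hq using step
    refine ⟨S.sup' hS q, ?_, (Finset.sup'_lt_iff hS).2 hq1, fun w hw x hx => ?_⟩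
    · obtain ⟨i, hi⟩ := hS
      exact (hq0 i hi).trans (Finset.le_sup' q hi)
    obtain ⟨i, hi, u, v, rfl, hu⟩ := exists_prefix_covering hS hw
    rw [applyWord_append, applyWord_cons, Pi.zero_apply, add_zero]
    refine (norm_applyWord_zero_le hle v _).trans ((hq i hi u hu x hx).trans ?_)
    gcongr
    exact Finset.le_sup' q hi

/-- Orbits of the semigroup generated by finitely many affine maps `x ↦ T i x + b i` are bounded if
the `T i` are symmetric and nonexpansive, preserve the norm of fixed points only, and `b i` is
orthogonal to the fixed points of `T i`. -/
theorem exists_norm_applyWord_le [FiniteDimensional ℝ X] [DecidableEq ι] {T : ι → X →ₗ[ℝ] X}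
    (hsymm : ∀ i, (T i).IsSymmetric) (hle : ∀ i x, ‖T i x‖ ≤ ‖x‖)
    (heq : ∀ i x, ‖T i x‖ = ‖x‖ → T i x = x) {b : ι → X}
    (hb : ∀ i x, T i x = x → inner ℝ x (b i) = 0) (S : Finset ι) :
    ∃ K : ℝ, 0 ≤ K ∧ ∀ w : List ι, (∀ i ∈ w, i ∈ S) → ‖applyWord T b w 0‖ ≤ K := by
  induction S using Finset.strongInduction with
  | H S ih =>
    have hb' : ∀ i ∈ S, b i ∈ (commonFixed T S)ᗮ := fun i hi x hx =>
      hb i x (mem_commonFixed.1 hx i hi)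
    obtain ⟨c, hc0, hc1, hc⟩ := exists_contraction_covering hsymm hle heq S
    choose! K hK0 hK using fun i (hi : i ∈ S) => ih _ (Finset.erase_ssubset hi)
    set D := ∑ i ∈ S, (K i + ‖b i‖) with hD
    have hterm : ∀ i ∈ S, K i + ‖b i‖ ≤ D := fun i hi =>
      Finset.single_le_sum (f := fun i => K i + ‖b i‖)
        (fun j hj => add_nonneg (hK0 j hj) (norm_nonneg _)) hi
    have hD0 : 0 ≤ D := Finset.sum_nonneg fun j hj => add_nonneg (hK0 j hj) (norm_nonneg _)
    have hc1' : 0 < 1 - c := sub_pos.2 hc1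
    -- The fixed point of `t ↦ c * t + D`, so the bound `B` is reproduced after every complete
    -- block.
    set B := D / (1 - c) with hB
    have hB0 : 0 ≤ B := div_nonneg hD0 hc1'.le
    have hBD : c * B + D = B := by
      rw [hB]; field_simp; ring
    have key : ∀ n : ℕ, ∀ w : List ι, w.length = n → (∀ i ∈ w, i ∈ S) →
        ∀ x ∈ (commonFixed T S)ᗮ, ‖x‖ ≤ B → ‖applyWord T b w x‖ ≤ B + D := by
      intro n
      induction n using Nat.strong_induction_on with
      | _ n ihn =>
        intro w hn hw x hx hxB
        by_cases hcov : w.toFinset = S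
        · rcases S.eq_empty_or_nonempty with hS | hS
          · have hw0 : w = [] := by simpa [hS] using hcov
            subst hw0
            simpa using hxB.trans (le_add_of_nonneg_right hD0)
          obtain ⟨i, hi, u, v, rfl, hu⟩ := exists_prefix_covering hS hcov
          have hui : ∀ j ∈ u ++ [i], j ∈ S := fun j hj => hw j (by
            simp only [List.mem_append, List.mem_cons] at hj ⊢
            tauto)
          rw [List.append_cons, applyWord_append]
          refine ihn v.length (by simp [← hn]; omega) v rfl
            (fun j hj => hw j (by simp [hj])) _
            (applyWord_mem_orthogonal hsymm hb' hui hx) ?_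
          have h1 : ‖applyWord T 0 (u ++ [i]) x‖ ≤ c * ‖x‖ := by
            refine hc _ ?_ x hx
            simp [hu, Finset.insert_erase hi]
          have h2 : ‖applyWord T b (u ++ [i]) 0‖ ≤ K i + ‖b i‖ := by
            rw [applyWord_append, applyWord_cons, applyWord_nil]
            refine (norm_add_le _ _).trans (add_le_add_left ((hle i _).trans ?_) _)
            exact hK i hi u fun j hj => hu ▸ List.mem_toFinset.2 hj
          calc ‖applyWord T b (u ++ [i]) x‖
              = ‖applyWord T 0 (u ++ [i]) x + applyWord T b (u ++ [i]) 0‖ := by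
                rw [← applyWord_add, add_zero]
            _ ≤ c * ‖x‖ + (K i + ‖b i‖) := (norm_add_le _ _).trans (add_le_add h1 h2)
            _ ≤ c * B + D := by gcongr; exact hterm i hi
            _ = B := hBD
        -- The incomplete final block misses a letter, so it adds at most `D`.
        · obtain ⟨i, hi, hiw⟩ : ∃ i ∈ S, i ∉ w := by
            by_contra! hall
            refine hcov (Finset.Subset.antisymm (fun j hj => hw j (List.mem_toFinset.1 hj))
              fun j hj => List.mem_toFinset.2 (hall j hj))
          have h2 : ‖applyWord T b w 0‖ ≤ D := by
            refine (hK i hi w fun j hj => Finset.mem_erase.2 ⟨?_, hw j hj⟩).trans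
              ((le_add_of_nonneg_right (norm_nonneg _)).trans (hterm i hi))
            rintro rfl
            exact hiw hj
          rw [← add_zero x, applyWord_add]
          exact (norm_add_le _ _).trans
            (add_le_add ((norm_applyWord_zero_le hle w x).trans hxB) h2)
    exact ⟨B + D, add_nonneg hB0 hD0, fun w hw =>
      key _ w rfl hw 0 (Submodule.zero_mem _) (by simpa using hB0)⟩

end RandomProducts

/-! ### Relaxed projections onto affine subspaces -/

section Relaxation

variable {X : Type*} [NormedAddCommGroup X] [InnerProductSpace ℝ X] [FiniteDimensional ℝ X]

/-- The relaxed projector `(1 - r) Id + r P_L` onto a linear subspace `L`. -/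
noncomputable def relaxedLinear (r : ℝ) (L : Submodule ℝ X) : X →ₗ[ℝ] X :=
  LinearMap.id - r • (Lᗮ.starProjection : X →ₗ[ℝ] X)

theorem relaxedLinear_apply (r : ℝ) (L : Submodule ℝ X) (x : X) :
    relaxedLinear r L x = x - r • Lᗮ.starProjection x := rfl

theorem relaxedLinear_isSymmetric (r : ℝ) (L : Submodule ℝ X) :
    (relaxedLinear r L).IsSymmetric := by
  intro x y
  have h := Submodule.starProjection_isSymmetric Lᗮ x y
  simp only [ContinuousLinearMap.coe_coe] at h
  simp only [relaxedLinear_apply, inner_sub_left, inner_sub_right, real_inner_smul_left,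
    real_inner_smul_right, h]

/-- For `0 < r < 2` the factor `r * (2 - r)` is positive, which gives nonexpansiveness and the
equality case at once. -/
theorem norm_relaxedLinear_sq (r : ℝ) (L : Submodule ℝ X) (x : X) :
    ‖relaxedLinear r L x‖ ^ 2 = ‖x‖ ^ 2 - r * (2 - r) * ‖Lᗮ.starProjection x‖ ^ 2 := by
  have h : inner ℝ x (Lᗮ.starProjection x) = ‖Lᗮ.starProjection x‖ ^ 2 := by
    have h0 := Submodule.starProjection_inner_eq_zero (K := Lᗮ) x _
      (Submodule.starProjection_apply_mem Lᗮ x)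
    rw [inner_sub_left, real_inner_self_eq_norm_sq] at h0
    linarith
  rw [relaxedLinear_apply, norm_sub_sq_real, real_inner_smul_right, h, norm_smul, mul_pow,
    Real.norm_eq_abs, sq_abs]
  ring

theorem norm_relaxedLinear_le {r : ℝ} (hr : r ∈ Set.Ioo (0 : ℝ) 2) (L : Submodule ℝ X) (x : X) :
    ‖relaxedLinear r L x‖ ≤ ‖x‖ := by
  refine (sq_le_sq₀ (norm_nonneg _) (norm_nonneg _)).1 ?_
  rw [norm_relaxedLinear_sq]
  have := mul_pos hr.1 (sub_pos.2 hr.2)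
  nlinarith [sq_nonneg ‖Lᗮ.starProjection x‖]

theorem relaxedLinear_eq_of_norm_eq {r : ℝ} (hr : r ∈ Set.Ioo (0 : ℝ) 2) (L : Submodule ℝ X)
    (x : X) (h : ‖relaxedLinear r L x‖ = ‖x‖) : relaxedLinear r L x = x := by
  have h1 := norm_relaxedLinear_sq r L x
  rw [h] at h1
  have h2 : r * (2 - r) * ‖Lᗮ.starProjection x‖ ^ 2 = 0 := by linarith
  have h3 : Lᗮ.starProjection x = 0 := by
    simpa [(mul_pos hr.1 (sub_pos.2 hr.2)).ne'] using
      (mul_eq_zero.1 h2).resolve_left (mul_pos hr.1 (sub_pos.2 hr.2)).ne'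
  simp [relaxedLinear_apply, h3]

theorem starProjection_eq_zero_of_relaxedLinear_eq {r : ℝ} (hr : 0 < r) {L : Submodule ℝ X}
    {x : X} (h : relaxedLinear r L x = x) : Lᗮ.starProjection x = 0 := by
  rw [relaxedLinear_apply, sub_eq_self, smul_eq_zero] at h
  exact h.resolve_left hr.ne'

/-- Each point lies in a bounded convex set that is invariant under the projectors with relaxation
parameters in `[0, r]`, `r < 2`, onto finitely many affine subspaces `c + L`. -/
theorem exists_bounded_invariant {𝒜 : Set (X × Submodule ℝ X)} (h𝒜 : 𝒜.Finite) {r : ℝ}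
    (hr : r ∈ Set.Ioo (0 : ℝ) 2) (x₀ : X) :
    ∃ B : Set X, x₀ ∈ B ∧ Bornology.IsBounded B ∧ ∀ A ∈ 𝒜, ∀ μ ∈ Set.Icc 0 r, ∀ x ∈ B,
      x - μ • A.2ᗮ.starProjection (x - A.1) ∈ B := by
  classical
  have : Fintype 𝒜 := h𝒜.fintype
  let T : 𝒜 → X →ₗ[ℝ] X := fun A => relaxedLinear r A.1.2
  let b : 𝒜 → X := fun A => r • A.1.2ᗮ.starProjection A.1.1
  have hle : ∀ A x, ‖T A x‖ ≤ ‖x‖ := fun A => norm_relaxedLinear_le hr _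
  obtain ⟨K, -, hK⟩ := exists_norm_applyWord_le (T := T) (b := b)
    (fun A => relaxedLinear_isSymmetric r _) hle
    (fun A => relaxedLinear_eq_of_norm_eq hr _) (fun A x hx => by
      have h0 := starProjection_eq_zero_of_relaxedLinear_eq hr.1 hx
      have h1 := Submodule.starProjection_isSymmetric A.1.2ᗮ x A.1.1
      simp only [ContinuousLinearMap.coe_coe] at h1
      simp only [b, real_inner_smul_right, ← h1, h0, inner_zero_left, mul_zero]) Finset.univ
  refine ⟨convexHull ℝ (Set.range fun w => applyWord T b w x₀),
    subset_convexHull ℝ _ ⟨[], rfl⟩, isBounded_convexHull.2 ?_, ?_⟩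
  · rw [isBounded_iff_forall_norm_le]
    refine ⟨‖x₀‖ + K, ?_⟩
    rintro _ ⟨w, rfl⟩
    have := applyWord_add T b w x₀ 0
    rw [add_zero] at this
    simp only [this]
    exact (norm_add_le _ _).trans
      (add_le_add (norm_applyWord_zero_le hle w x₀) (hK w (by simp)))
  · intro A hA μ hμ x hx
    have hfull : T ⟨A, hA⟩ x + b ⟨A, hA⟩ ∈
        convexHull ℝ (Set.range fun w => applyWord T b w x₀) := by
      -- An affine preimage of the hull is convex, and it contains the orbit because words can be
      -- extended by one letter.
      have hsub : convexHull ℝ (Set.range fun w => applyWord T b w x₀) ⊆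
          (T ⟨A, hA⟩) ⁻¹' ((fun y => y + b ⟨A, hA⟩) ⁻¹'
            convexHull ℝ (Set.range fun w => applyWord T b w x₀)) := by
        refine convexHull_min ?_ (Convex.linear_preimage
          ((convex_convexHull ℝ _).translate_preimage_left _) _)
        rintro _ ⟨w, rfl⟩
        exact subset_convexHull ℝ _ ⟨w ++ [⟨A, hA⟩], by simp [applyWord_append]⟩
      exact hsub hx
    have hcomb := convex_convexHull ℝ (Set.range fun w => applyWord T b w x₀) hx hfull
      (a := 1 - μ / r) (b := μ / r) (sub_nonneg.2 ((div_le_one hr.1).2 hμ.2))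
      (div_nonneg hμ.1 hr.1.le) (by ring)
    convert hcomb using 1
    have hμr : μ = μ / r * r := by field_simp [hr.1.ne']
    simp only [T, b, relaxedLinear_apply, map_sub]
    generalize A.2ᗮ.starProjection x = y
    generalize A.2ᗮ.starProjection A.1 = z
    conv_lhs => rw [hμr]
    module

end Relaxation

/-! ### Faces of polyhedral sets -/

section Polyhedral

variable {X : Type*} [NormedAddCommGroup X] [InnerProductSpace ℝ X]

theorem IsNearestPoint.inner_le_zero {C : Set X} (hC : Convex ℝ C) {x p : X}
    (hp : IsNearestPoint C x p) {z : X} (hz : z ∈ C) : inner ℝ (x - p) (z - p) ≤ 0 := by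
  refine (norm_eq_iInf_iff_real_inner_le_zero hC hp.1).1 ?_ z hz
  have : Nonempty C := ⟨⟨p, hp.1⟩⟩
  refine le_antisymm (le_ciInf fun w => hp.2 w w.2) ?_
  exact ciInf_le (f := fun w : C => ‖x - w‖)
    ⟨0, by rintro _ ⟨w, rfl⟩; exact norm_nonneg _⟩ ⟨p, hp.1⟩

/-- Nearest points in a polyhedral set are the projections onto finitely many affine subspaces
`c + L`. -/
theorem IsPolyhedralSet.exists_finite_affine {C : Set X} (hC : IsPolyhedralSet C) :
    ∃ 𝒜 : Set (X × Submodule ℝ X), 𝒜.Finite ∧ ∀ x p, IsNearestPoint C x p →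
      ∃ A ∈ 𝒜, p - A.1 ∈ A.2 ∧ x - p ∈ A.2ᗮ := by
  have hconv := hC.convex
  obtain ⟨𝓗, hfin, h, rfl⟩ := hC
  choose! a β _ hH using h
  let J : X → Set (Set X) := fun p => {H ∈ 𝓗 | inner ℝ (a H) p = β H}
  let L : Set (Set X) → Submodule ℝ X := fun I => (Submodule.span ℝ (a '' I))ᗮ
  have hmem : ∀ I d, d ∈ L I ↔ ∀ H ∈ I, inner ℝ (a H) d = 0 := fun I d => by
    simp only [L, Submodule.mem_orthogonal]
    refine ⟨fun hd H hI => hd _ (Submodule.subset_span ⟨H, hI, rfl⟩), fun hd u hu => ?_⟩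
    induction hu using Submodule.span_induction with
    | mem u hu => obtain ⟨H, hI, rfl⟩ := hu; exact hd H hI
    | zero => simp
    | add u v _ _ hu hv => rw [inner_add_left, hu, hv, add_zero]
    | smul t u _ hu => rw [real_inner_smul_left, hu, mul_zero]
  have hJfin : (Set.range J).Finite :=
    hfin.finite_subsets.subset (by rintro _ ⟨p, rfl⟩; exact fun H hH => hH.1)
  -- The base point depends only on the active set `J p`, not on `p`, which keeps the family finite.
  refine ⟨(fun I => (Function.invFun J I, L I)) '' Set.range J, hJfin.image _, fun x p hp =>
    ⟨_, ⟨J p, ⟨p, rfl⟩, rfl⟩, ?_, ?_⟩⟩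
  · have hc : J (Function.invFun J (J p)) = J p := Function.invFun_eq ⟨p, rfl⟩
    refine (hmem _ _).2 fun H hI => ?_
    have h1 := hI.2
    rw [← hc] at hI
    rw [inner_sub_right, h1, hI.2, sub_self]
  -- A small move from `p` along `d` keeps active constraints tight and inactive ones slack, so it
  -- stays in the set; using both `d` and `-d` gives orthogonality.
  · have hhalf : ∀ d ∈ L (J p), inner ℝ (x - p) d ≤ 0 := by
      intro d hd
      have hev : ∀ H ∈ 𝓗, ∀ᶠ t : ℝ in nhdsWithin 0 (Set.Ioi 0), p + t • d ∈ H := by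
        intro H hHm
        have hpH : inner ℝ (a H) p ≤ β H := by
          have := hp.1 H hHm
          rwa [hH H hHm] at this
        rcases hpH.eq_or_lt with heq | hlt
        · refine Filter.Eventually.of_forall fun t => ?_
          rw [hH H hHm]
          simp [inner_add_right, real_inner_smul_right, (hmem _ _).1 hd H ⟨hHm, heq⟩, heq]
        · have hcont : Continuous fun t : ℝ => inner ℝ (a H) (p + t • d) := by fun_prop
          have := (hcont.tendsto 0).eventually_lt_const (u := β H) (by simpa using hlt)
          filter_upwards [nhdsWithin_le_nhds this] with t ht
          rw [hH H hHm]
          exact ht.le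
      obtain ⟨t, ht, ht0⟩ := (((Filter.eventually_all_finite hfin).2 hev).and
        self_mem_nhdsWithin).exists
      have h1 := hp.inner_le_zero hconv (z := p + t • d) fun H hHm => ht H hHm
      rw [add_sub_cancel_left, real_inner_smul_right] at h1
      exact nonpos_of_mul_nonpos_right h1 ht0
    refine (Submodule.mem_orthogonal' _ _).2 fun d hd => le_antisymm (hhalf d hd) ?_
    have := hhalf (-d) (Submodule.neg_mem _ hd)
    rw [inner_neg_right] at this
    linarith

end Polyhedral

theorem theorem2p5 {X : Type*} [NormedAddCommGroup X] [InnerProductSpace ℝ X]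
    [FiniteDimensional ℝ X]
    (𝒞 : Set (Set X)) (h𝒞_fin : 𝒞.Finite) (h𝒞_ne : 𝒞.Nonempty)
    (h𝒞 : ∀ C ∈ 𝒞, C.Nonempty ∧ IsPolyhedralSet C)
    (lam : ℝ) (hlam : lam ∈ Set.Ico (0 : ℝ) 2)
    (x : ℕ → X) (R : ℕ → X → X)
    (hR : ∀ n, R n ∈ relaxedProjectors 𝒞 (Set.Icc 0 lam))
    (hx : ∀ n, x (n + 1) = R n (x n)) :
    Bornology.IsBounded (Set.range x) := by
  choose! 𝒜 h𝒜fin h𝒜 using fun C hC => (h𝒞 C hC).2.exists_finite_affine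
  obtain ⟨B, hB0, hB, hinv⟩ := exists_bounded_invariant (h𝒞_fin.biUnion h𝒜fin)
    -- The maximum with `1` ensures `r > 0` even when `lam = 0`.
    (r := max lam 1) ⟨lt_max_of_lt_right one_pos, max_lt hlam.2 one_lt_two⟩ (x 0)
  refine hB.subset ?_
  rintro _ ⟨n, rfl⟩
  induction n with
  | zero => exact hB0
  | succ n ih =>
    obtain ⟨C, hC, μ, hμ, hRn⟩ := hR n
    obtain ⟨A, hA, h1, h2⟩ := h𝒜 C hC _ _
      (projector_isNearestPoint (h𝒞 C hC).1 (h𝒞 C hC).2.isClosed (x n))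
    have hmem := hinv A (Set.mem_biUnion hC hA) μ ⟨hμ.1, hμ.2.trans (le_max_left _ _)⟩ _ ih
    rw [hx, hRn]
    convert hmem using 1
    have hproj : A.2ᗮ.starProjection (x n - A.1) = x n - projector C (x n) := by
      refine Submodule.eq_starProjection_of_mem_orthogonal h2 ?_
      rw [sub_sub_sub_cancel_left, Submodule.orthogonal_orthogonal]
      exact h1
    rw [hproj]
    module
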